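/- Let $(q_i)_{i\ge 1}$ be a sequence of prime powers with $q_i\to\infty$, and let $n_i\ge 3$ (bounded or not), $m_i$ and $\ell_i$ be integers with $1\le m_i\le n_i$ and $\ell_i\ge m_i+1$, where the sequences $(m_i)$ and $(\ell_i)$ are bounded. Write $q=q_i$, $n=n_i$, $m=m_i$, $\ell=\ell_i$. For $\theta=\theta_i\in[0,1]$ let $X\subseteq\mathbb F_q^n$ be the random subset that contains each element of $\mathbb F_q^n$ with probability $\theta$, independently of all other elements. An $m$-flat is a translate of an $m$-dimensional linear subspace of $\mathbb F_q^n$; an $m$-flat $L$ is $\ell$-rich with regard to $X$ if $|L\cap X|\ge \ell$. Let $\Gamma$ be the event that there is an $m$-flat that is $\ell$-rich with regard to $X$. Then $\Gamma$ has threshold $$t=\bigl(q^{(n-m)(m+1)+m\ell}\bigr)^{-1/\ell},$$ that is, as $i\to\infty$: $\Pr[\Gamma]\to 0$ for every choice of $\theta=\theta_i$ with $\theta=o(t)$, and $\Pr[\Gamma]\to 1$ for every choice of $\theta=\theta_i$ with $\theta=\omega(t)$. -/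

import Mathlib

open Filter Topology Asymptotics MeasureTheory ProbabilityTheory

/-- An `m`-flat in a vector space `V`: a nonempty affine subspace of dimension `m`, that is, a
translate of an `m`-dimensional linear subspace. -/
def IsFlat {K V : Type*} [Field K] [AddCommGroup V] [Module K V] (m : ℕ)
    (L : AffineSubspace K V) : Prop :=
  (L : Set V).Nonempty ∧ Module.finrank K L.direction = m

/-- The flat `L` is `ℓ`-rich with regard to a point set `X` of a finite vector space:
`|L ∩ X| ≥ ℓ`. -/
def IsRich {K V : Type*} [Field K] [AddCommGroup V] [Module K V] [Finite V] (ℓ : ℕ)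
    (X : Set V) (L : AffineSubspace K V) : Prop :=
  ℓ ≤ ((L : Set V) ∩ X).ncard

/-- The event (as a family of point sets `X ⊆ K ^ n`) that some `m`-flat is `ℓ`-rich with regard
to `X`. -/
def richFlatEvent (K : Type*) [Field K] [Finite K] (n m ℓ : ℕ) : Set (Set (Fin n → K)) :=
  {X | ∃ L : AffineSubspace K (Fin n → K), IsFlat m L ∧ IsRich ℓ X L}

/-- Let `U i` be finite sets and `Γ i` a family of subsets of `U i`. The function `t` is a threshold
for `Γ` if, for the random subset `X i` of `U i` that contains each element independently with
probability `θ i`, the probability that `X i ∈ Γ i` tends to `0` whenever `θ = o(t)`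
and tends to `1` whenever `θ = ω(t)`. -/
def IsThreshold {U : ℕ → Type*} [∀ i, Finite (U i)] (Γ : ∀ i, Set (Set (U i))) (t : ℕ → ℝ) :
    Prop :=
  (∀ θ : ℕ → unitInterval, (fun i => (θ i : ℝ)) =o[atTop] t →
    Tendsto (fun i => (setBernoulli (Set.univ : Set (U i)) (θ i)).real (Γ i)) atTop (𝓝 0)) ∧
  (∀ θ : ℕ → unitInterval, t =o[atTop] (fun i => (θ i : ℝ)) →
    Tendsto (fun i => (setBernoulli (Set.univ : Set (U i)) (θ i)).real (Γ i)) atTop (𝓝 1))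

/-!
Write `q = |K|` and `Q = q ^ ((n - m)(m + 1) + m ℓ)`, so that the threshold `t` satisfies
`t ^ ℓ * Q = 1`. Up to constants depending only on `m` and `ℓ`, and for large `q`, the number of
pairs of an `m`-flat and an `ℓ`-subset of it is `Q`.

*Below the threshold* a first moment bound suffices. There are at most a constant times
`q ^ ((n - m)(m + 1))` flats (`card_flats_mul_le`), each with at most `(q ^ m) ^ ℓ` subsets of size
`ℓ`, so the event has probability at most a constant times `Q θ ^ ℓ = (θ / t) ^ ℓ`
(`setBernoulli_real_richFlatEvent_le`).

*Above the threshold* the second moment method is applied to the `ℓ`-subsets that lie in an `m`-flat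
in general position, meaning that any `m + 1` of their points are affinely independent
(`generalSets`). Without this restriction the variance could be too large: many flats may pass
through a common degenerate set of points. General position has two consequences.

* When `q` is large, a greedy construction still produces at least a constant times `Q` such sets:
  each new point only has to avoid boundedly many flats of dimension less than `m`
  (`le_card_generalSets`).
* Any `m + 1` points of such a set determine its flat, so a given set of `j` points extends to at
  most `q ^ (n (m + 1 - j) + m (ℓ - m - 1))` of these sets if `j ≤ m + 1`, and to at most
  `q ^ (m (ℓ - j))` if `j ≥ m + 1`. Both bounds are at most `Q t ^ j`, because
  `q ^ (-n) ≤ t ≤ q ^ (-m)` (`card_generalSets_superset_le_mul_pow`).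

Chebyshev's inequality, in the form `setBernoulli_real_forall_not_subset_le`, then bounds the
probability that no such set lies in the random set by a constant times `t / θ`
(`one_sub_le_setBernoulli_real_richFlatEvent`).
-/

/-! ### First and second moment bounds for random subsets -/

lemma setBernoulli_real_superset {U : Type*} [Finite U] (θ : unitInterval) (S : Finset U) :
    (setBernoulli (Set.univ : Set U) θ).real {X | (S : Set U) ⊆ X} = (θ : ℝ) ^ S.card := by
  have := Fintype.ofFinite U
  rw [measureReal_def, setBernoulli_apply']
  have : ((fun p : U → Prop => {i | p i}) ⁻¹' {X | (S : Set U) ⊆ X}) =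
      Set.pi (S : Set U) (fun _ => {True}) := by
    ext p
    simp [Set.pi, Set.subset_def]
  rw [this, Measure.infinitePi_pi]
  · simp
  · simp

/-- Second moment method for a uniform family `𝓢`: if, for every nonempty subset `T` of a member of
`𝓢`, the expected number of members of `𝓢` in the random set `X`, conditioned on `T ⊆ X` and counting
only those that contain `T`, is at most `ε` times the unconditional expected number of members of `𝓢`
in `X`, then the probability that `X` contains no member of `𝓢` is at most `2 ^ ℓ * ε`. -/
lemma setBernoulli_real_forall_not_subset_le {U : Type*} [Finite U] [DecidableEq U]
    (θ : unitInterval) (hθ : 0 < (θ : ℝ)) (ℓ : ℕ) (𝓢 : Finset (Finset U)) (h𝓢 : 𝓢.Nonempty)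
    (hcard : ∀ S ∈ 𝓢, S.card = ℓ) (ε : ℝ) (hε₀ : 0 ≤ ε)
    (hext : ∀ S ∈ 𝓢, ∀ T ⊆ S, T.Nonempty →
      ((𝓢.filter (T ⊆ ·)).card : ℝ) ≤ ε * (θ : ℝ) ^ T.card * 𝓢.card) :
    (setBernoulli (Set.univ : Set U) θ).real {X | ∀ S ∈ 𝓢, ¬ (S : Set U) ⊆ X} ≤ 2 ^ ℓ * ε := by
  classical
  set μ := setBernoulli (Set.univ : Set U) θ
  have hint (f : Set U → ℝ) : Integrable f μ := Integrable.of_finite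
  set M : ℝ := 𝓢.card * (θ : ℝ) ^ ℓ with hM
  have hN : (0 : ℝ) < 𝓢.card := by exact_mod_cast h𝓢.card_pos
  have hMpos : 0 < M := by positivity
  -- The number of members of `𝓢` contained in the random set; its mean is `M`.
  let Y : Set U → ℝ := fun X => ∑ S ∈ 𝓢, {X : Set U | (S : Set U) ⊆ X}.indicator 1 X
  have hI (S : Finset U) : ∫ X, {X : Set U | (S : Set U) ⊆ X}.indicator (1 : Set U → ℝ) X ∂μ =
      (θ : ℝ) ^ S.card := by
    rw [integral_indicator_one (MeasurableSet.of_discrete), setBernoulli_real_superset]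
  have hY : ∫ X, Y X ∂μ = M := by
    rw [integral_finsetSum _ (fun _ _ => hint _), Finset.sum_congr rfl (fun S hS => by
      rw [hI, hcard S hS])]
    simp [hM]
  have hYY : ∫ X, Y X * Y X ∂μ = ∑ S ∈ 𝓢, ∑ S' ∈ 𝓢, (θ : ℝ) ^ (S ∪ S').card := by
    simp only [Y, Finset.sum_mul_sum]
    rw [integral_finsetSum _ (fun _ _ => hint _)]
    refine Finset.sum_congr rfl fun S _ => ?_
    rw [integral_finsetSum _ (fun _ _ => hint _)]
    refine Finset.sum_congr rfl fun S' _ => ?_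
    rw [← hI]
    congr 1
    ext X
    by_cases h1 : (S : Set U) ⊆ X <;> by_cases h2 : (S' : Set U) ⊆ X <;>
      simp [Set.indicator, h1, h2]
  have hvar : ∫ X, (Y X - M) ^ 2 ∂μ =
      ∑ S ∈ 𝓢, ∑ S' ∈ 𝓢, ((θ : ℝ) ^ (S ∪ S').card - (θ : ℝ) ^ (2 * ℓ)) := by
    have : (fun X => (Y X - M) ^ 2) = fun X => Y X * Y X - 2 * M * Y X + M ^ 2 := by
      ext X; ring
    rw [this, integral_add (hint _) (hint _), integral_sub (hint _) (hint _), hYY,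
      integral_const_mul, hY]
    simp only [Finset.sum_sub_distrib, Finset.sum_const, integral_const, probReal_univ, hM,
      nsmul_eq_mul, smul_eq_mul]
    ring
  -- Chebyshev's inequality: `(Y - M) ^ 2 = M ^ 2` wherever `Y = 0`.
  have hcheb : M ^ 2 * μ.real {X | ∀ S ∈ 𝓢, ¬ (S : Set U) ⊆ X} ≤ ∫ X, (Y X - M) ^ 2 ∂μ := by
    rw [← integral_indicator_one (MeasurableSet.of_discrete), ← integral_const_mul]
    refine integral_mono (hint _) (hint _) fun X => ?_
    by_cases hX : X ∈ {X : Set U | ∀ S ∈ 𝓢, ¬ (S : Set U) ⊆ X}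
    · have h0 : Y X = 0 := Finset.sum_eq_zero fun S hS => by
        simp [Set.indicator, hX S hS]
      simp [hX, h0]
    · simp only [Set.indicator_of_notMem hX, mul_zero]
      positivity
  -- Only members `S'` meeting `S` contribute to the variance; they are grouped by `T = S ∩ S'`, and
  -- summing over all nonempty `T ⊆ S` contained in `S'` gives an upper bound.
  have hbound : ∀ S ∈ 𝓢, ∑ S' ∈ 𝓢, ((θ : ℝ) ^ (S ∪ S').card - (θ : ℝ) ^ (2 * ℓ)) ≤
      2 ^ ℓ * ε * 𝓢.card * (θ : ℝ) ^ (2 * ℓ) := by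
    intro S hS
    have hε : 0 ≤ ε * 𝓢.card * (θ : ℝ) ^ (2 * ℓ) := by positivity
    calc ∑ S' ∈ 𝓢, ((θ : ℝ) ^ (S ∪ S').card - (θ : ℝ) ^ (2 * ℓ))
        ≤ ∑ S' ∈ 𝓢, ∑ T ∈ S.powerset.filter (·.Nonempty),
            if T ⊆ S' then (θ : ℝ) ^ (2 * ℓ - T.card) else 0 := by
          refine Finset.sum_le_sum fun S' hS' => ?_
          have hnn : ∀ T ∈ S.powerset.filter (·.Nonempty),
              0 ≤ if T ⊆ S' then (θ : ℝ) ^ (2 * ℓ - T.card) else 0 := by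
            intro T _; split_ifs <;> positivity
          have hc := Finset.card_union_add_card_inter S S'
          rw [hcard S hS, hcard S' hS'] at hc
          rcases (S ∩ S').eq_empty_or_nonempty with he | hne
          · rw [he, Finset.card_empty] at hc
            rw [show (S ∪ S').card = 2 * ℓ by omega, sub_self]
            exact Finset.sum_nonneg hnn
          · refine le_trans ?_ (Finset.single_le_sum hnn
              (a := S ∩ S') (by simp [hne, Finset.inter_subset_left]))
            rw [if_pos Finset.inter_subset_right,
              show (S ∪ S').card = 2 * ℓ - (S ∩ S').card by omega]
            linarith [pow_pos hθ (2 * ℓ)]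
      _ = ∑ T ∈ S.powerset.filter (·.Nonempty),
            ((𝓢.filter (T ⊆ ·)).card : ℝ) * (θ : ℝ) ^ (2 * ℓ - T.card) := by
          rw [Finset.sum_comm]
          simp [← Finset.sum_filter]
      _ ≤ ∑ T ∈ S.powerset.filter (·.Nonempty), ε * 𝓢.card * (θ : ℝ) ^ (2 * ℓ) := by
          refine Finset.sum_le_sum fun T hT => ?_
          simp only [Finset.mem_filter, Finset.mem_powerset] at hT
          have hTc := Finset.card_le_card hT.1
          rw [hcard S hS] at hTc
          refine (mul_le_mul_of_nonneg_right (hext S hS T hT.1 hT.2) (by positivity)).trans_eq ?_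
          rw [show (θ : ℝ) ^ (2 * ℓ) = (θ : ℝ) ^ T.card * (θ : ℝ) ^ (2 * ℓ - T.card) by
            rw [← pow_add]; congr 1; omega]
          ring
      _ ≤ 2 ^ ℓ * ε * 𝓢.card * (θ : ℝ) ^ (2 * ℓ) := by
          rw [Finset.sum_const, nsmul_eq_mul, mul_assoc (2 ^ ℓ), mul_assoc (2 ^ ℓ)]
          refine mul_le_mul_of_nonneg_right ?_ hε
          have := (Finset.card_filter_le S.powerset (·.Nonempty))
          rw [Finset.card_powerset, hcard S hS] at this
          exact_mod_cast this
  have htot : M ^ 2 * μ.real {X | ∀ S ∈ 𝓢, ¬ (S : Set U) ⊆ X} ≤ M ^ 2 * (2 ^ ℓ * ε) := by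
    refine hcheb.trans (hvar.trans_le ((Finset.sum_le_sum hbound).trans_eq ?_))
    simp only [Finset.sum_const, nsmul_eq_mul, hM]
    ring
  exact le_of_mul_le_mul_left htot (by positivity)

/-- First moment bound, by the union bound over all `ℓ`-subsets of members of `𝓛`. -/
lemma setBernoulli_real_exists_le_ncard_inter_le {U : Type*} [Finite U] (θ : unitInterval)
    (𝓛 : Finset (Set U)) (M ℓ : ℕ) (hM : ∀ L ∈ 𝓛, L.ncard ≤ M) :
    (setBernoulli (Set.univ : Set U) θ).real {X | ∃ L ∈ 𝓛, ℓ ≤ (L ∩ X).ncard} ≤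
      𝓛.card * (M : ℝ) ^ ℓ * (θ : ℝ) ^ ℓ := by
  classical
  have := Fintype.ofFinite U
  have hsub : {X : Set U | ∃ L ∈ 𝓛, ℓ ≤ (L ∩ X).ncard} ⊆
      ⋃ L ∈ 𝓛, ⋃ S ∈ L.toFinset.powersetCard ℓ, {X : Set U | (S : Set U) ⊆ X} := by
    rintro X ⟨L, hL, hX⟩
    rw [Set.ncard_eq_toFinset_card'] at hX
    obtain ⟨S, hS, hSc⟩ := Finset.exists_subset_card_eq hX
    simp only [Set.mem_iUnion]
    have hS' : (S : Set U) ⊆ L ∩ X := fun x hx => by simpa using hS hx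
    refine ⟨L, hL, S, ?_, hS'.trans Set.inter_subset_right⟩
    rw [Finset.mem_powersetCard]
    exact ⟨fun x hx => by simpa using (hS' hx).1, hSc⟩
  refine (measureReal_mono hsub (measure_ne_top _ _)).trans ?_
  refine (measureReal_biUnion_finset_le _ _).trans ?_
  rw [mul_assoc, ← nsmul_eq_mul]
  refine Finset.sum_le_card_nsmul _ _ _ fun L hL => ?_
  refine (measureReal_biUnion_finset_le _ _).trans ?_
  have hc : ((L.toFinset.powersetCard ℓ).card : ℝ) ≤ (M : ℝ) ^ ℓ := by
    rw [Finset.card_powersetCard, ← Set.ncard_eq_toFinset_card']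
    exact_mod_cast (Nat.choose_le_pow _ _).trans (Nat.pow_le_pow_left (hM L hL) _)
  refine le_trans ?_ (mul_le_mul_of_nonneg_right hc (pow_nonneg θ.2.1 ℓ))
  rw [← nsmul_eq_mul]
  refine Finset.sum_le_card_nsmul _ _ _ fun S hS => ?_
  rw [setBernoulli_real_superset, (Finset.mem_powersetCard.1 hS).2]

/-! ### Sets in general position in a flat -/

/-- Double counting of the pairs `(S, insert p S)`: the set `S` is recovered from `insert p S` and
`p`. -/
lemma sum_card_insert_le {V : Type*} [Finite V] [DecidableEq V] (𝓐 𝓑 : Finset (Finset V)) (k : ℕ)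
    (h𝓑 : ∀ S ∈ 𝓑, S.card = k) :
    ∑ S ∈ 𝓐, {p : V | p ∉ S ∧ insert p S ∈ 𝓑}.ncard ≤ 𝓑.card * k := by
  classical
  have := Fintype.ofFinite V
  have h : 𝓑.card * k = (𝓑.sigma fun S => S).card := by
    rw [Finset.card_sigma, Finset.sum_congr rfl h𝓑]; simp
  simp_rw [Set.ncard_eq_toFinset_card']
  rw [h, ← Finset.card_sigma]
  refine Finset.card_le_card_of_injOn (fun x => ⟨insert x.2 x.1, x.2⟩) ?_ ?_
  · rintro ⟨S, p⟩ hx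
    simp only [Finset.coe_sigma, Set.mem_sigma_iff, Set.coe_toFinset, Set.mem_ofPred_eq] at hx
    simp [hx.2.2]
  · rintro ⟨S, p⟩ hx ⟨S', p'⟩ hx' h
    simp only [Finset.coe_sigma, Set.mem_sigma_iff, Set.coe_toFinset, Set.mem_ofPred_eq]
      at hx hx'
    simp only [Sigma.mk.injEq, heq_eq_eq] at h
    obtain ⟨h, rfl⟩ := h
    have : S = S' := by
      rw [← Finset.erase_insert hx.2.1, h, Finset.erase_insert hx'.2.1]
    rw [this]

section Counting
variable {K V : Type*} [Field K] [AddCommGroup V] [Module K V]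

lemma affineIndependent_insert_of_notMem {S : Set V} {p : V}
    (hS : AffineIndependent K (Subtype.val : S → V)) (hp : p ∉ affineSpan K S) :
    AffineIndependent K (Subtype.val : ↥(insert p S : Set V) → V) := by
  have hpS : p ∉ S := fun h => hp (subset_affineSpan K S h)
  have himg : (Subtype.val : ↥(insert p S : Set V) → V) '' {x | x ≠ ⟨p, Set.mem_insert _ _⟩} ⊆ S := by
    rintro _ ⟨⟨x, hx⟩, hne, rfl⟩
    exact hx.resolve_left fun h => hne (Subtype.ext h)
  refine AffineIndependent.affineIndependent_of_notMem_span (i := ⟨p, Set.mem_insert _ _⟩) ?_ ?_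
  · exact hS.comp_embedding ⟨fun x => ⟨x.1.1, himg ⟨x.1, x.2, rfl⟩⟩, fun x y h =>
      Subtype.ext (Subtype.ext (by simpa [Subtype.ext_iff] using h))⟩
  · exact fun h => hp (affineSpan_mono K himg h)

lemma finrank_vectorSpan_of_affineIndependent {B : Finset V} {m : ℕ} (hB : B.card = m + 1)
    (h : AffineIndependent K (Subtype.val : ↥(B : Set V) → V)) :
    Module.finrank K (vectorSpan K (B : Set V)) = m := by
  have := h.finrank_vectorSpan (n := m) (by simpa using hB)
  rwa [Subtype.range_coe] at this

variable [Finite V]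

lemma ncard_affineSubspace (W : AffineSubspace K V) (hW : (W : Set V).Nonempty) :
    (W : Set V).ncard = Nat.card K ^ Module.finrank K W.direction := by
  have : Nonempty W := hW.to_subtype
  rw [← Module.natCard_eq_pow_finrank (K := K) (V := W.direction), ← Nat.card_coe_set_eq]
  exact Nat.card_congr (Equiv.vaddConst (Classical.arbitrary W)).symm

lemma ncard_affineSpan_le [Finite K] (A : Finset V) (r : ℕ) (hA : A.card ≤ r + 1) :
    (affineSpan K (A : Set V) : Set V).ncard ≤ Nat.card K ^ r := by
  classical
  rcases A.eq_empty_or_nonempty with rfl | hne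
  · simp
  · rw [ncard_affineSubspace _ ((affineSpan_nonempty K).2 hne), direction_affineSpan]
    refine Nat.pow_le_pow_right Nat.card_pos ?_
    obtain ⟨c, hc⟩ := Nat.exists_eq_succ_of_ne_zero hne.card_pos.ne'
    have := finrank_vectorSpan_image_finset_le K (id : V → V) A hc
    rw [Finset.image_id] at this
    omega

/-- The `k`-point subsets of `W` that are in general position in some `m`-flat: any at most `m + 1`
of their points are affinely independent, and they span a flat of dimension at most `m`. The
dimension is `m` as soon as `k ≥ m + 1`; for smaller `k` the last condition is automatic. -/
noncomputable def generalSets (m k : ℕ) (W : AffineSubspace K V) : Finset (Finset V) :=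
  (Set.toFinite {S : Finset V | S.card = k ∧ (S : Set V) ⊆ W ∧
    (∀ B ⊆ S, B.card ≤ m + 1 → AffineIndependent K (Subtype.val : ↥(B : Set V) → V)) ∧
    Module.finrank K (vectorSpan K (S : Set V)) ≤ m}).toFinset

lemma mem_generalSets {m k : ℕ} {W : AffineSubspace K V} {S : Finset V} :
    S ∈ generalSets m k W ↔ S.card = k ∧ (S : Set V) ⊆ W ∧
    (∀ B ⊆ S, B.card ≤ m + 1 → AffineIndependent K (Subtype.val : ↥(B : Set V) → V)) ∧
    Module.finrank K (vectorSpan K (S : Set V)) ≤ m := by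
  simp [generalSets]

lemma affineSpan_eq_of_subset {m : ℕ} {W : AffineSubspace K V} {B : Finset V}
    (hW : Module.finrank K W.direction ≤ m) (hB : B.card = m + 1) (hBW : (B : Set V) ⊆ W)
    (h : AffineIndependent K (Subtype.val : ↥(B : Set V) → V)) : affineSpan K (B : Set V) = W := by
  have hle : affineSpan K (B : Set V) ≤ W := affineSpan_le.2 hBW
  refine AffineSubspace.eq_of_direction_eq_of_nonempty_of_le ?_
    ((affineSpan_nonempty K).2 (Finset.card_pos.1 (by omega))) hle
  refine Submodule.eq_of_le_of_finrank_le (AffineSubspace.direction_le hle) ?_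
  rwa [direction_affineSpan, finrank_vectorSpan_of_affineIndependent hB h]

/-- Any `m + 1` points of a set in general position determine the flat it spans. -/
lemma affineSpan_eq_of_mem_generalSets {m k : ℕ} {W : AffineSubspace K V} {S B : Finset V}
    (hS : S ∈ generalSets m k W) (hBS : B ⊆ S) (hB : B.card = m + 1) :
    affineSpan K (B : Set V) = affineSpan K (S : Set V) := by
  obtain ⟨-, -, hind, hrank⟩ := mem_generalSets.1 hS
  refine affineSpan_eq_of_subset (by rwa [direction_affineSpan]) hB ?_ (hind B hBS hB.le)
  exact (Finset.coe_subset.2 hBS).trans (subset_affineSpan K _)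

lemma isFlat_affineSpan_of_mem_generalSets {m k : ℕ} {W : AffineSubspace K V} {S : Finset V}
    (hS : S ∈ generalSets m k W) (hk : m + 1 ≤ k) : IsFlat m (affineSpan K (S : Set V)) := by
  obtain ⟨hc, -, hind, -⟩ := mem_generalSets.1 hS
  obtain ⟨B, hBS, hB⟩ := Finset.exists_subset_card_eq (hk.trans_eq hc.symm)
  rw [← affineSpan_eq_of_mem_generalSets hS hBS hB]
  refine ⟨(affineSpan_nonempty K).2 (Finset.card_pos.1 (by omega)), ?_⟩
  rw [direction_affineSpan, finrank_vectorSpan_of_affineIndependent hB (hind B hBS hB.le)]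

/-- A new point preserves general position if it lies in no flat spanned by at most `m` of the
points and, when the points already span an `m`-flat, stays in that flat. -/
lemma insert_mem_generalSets [DecidableEq V] {m k : ℕ} {W : AffineSubspace K V}
    {S : Finset V} {p : V}
    (hS : S ∈ generalSets m k W) (hpW : p ∈ W)
    (hp : ∀ A ⊆ S, A.card ≤ m → p ∉ affineSpan K (A : Set V)) (hpS : p ∉ S)
    (hk : k ≤ m ∨ p ∈ affineSpan K (S : Set V)) : insert p S ∈ generalSets m (k + 1) W := by
  obtain ⟨hc, hSW, hind, hrank⟩ := mem_generalSets.1 hS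
  refine mem_generalSets.2 ⟨by rw [Finset.card_insert_of_notMem hpS, hc], ?_, ?_, ?_⟩
  · rw [Finset.coe_insert]
    exact Set.insert_subset hpW hSW
  · intro B hB hBc
    by_cases hpB : p ∈ B
    · have hsub : B.erase p ⊆ S := by
        rwa [← Finset.subset_insert_iff]
      have hcard : (B.erase p).card ≤ m := by rw [Finset.card_erase_of_mem hpB]; omega
      rw [← Finset.insert_erase hpB, Finset.coe_insert]
      exact affineIndependent_insert_of_notMem (hind _ hsub (by omega)) (hp _ hsub hcard)
    · exact hind B ((Finset.subset_insert_iff_of_notMem hpB).1 hB) hBc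
  · rcases hk with hk | hk
    · have := finrank_vectorSpan_image_finset_le K (id : V → V) (insert p S) (n := k)
        (by rw [Finset.card_insert_of_notMem hpS, hc])
      rw [Finset.image_id] at this
      exact this.trans hk
    · rwa [Finset.coe_insert, vectorSpan_insert_eq_vectorSpan hk]

/-- The greedy step: the at most `2 ^ k` forbidden flats have at most `q ^ (m - 1)` points each,
which for `q ≥ 2 ^ (k + 1)` leaves at least half of `W'` for the new point. -/
lemma card_extensions_ge [Finite K] [DecidableEq V] {m k e : ℕ} (hm : 1 ≤ m)
    {W W' : AffineSubspace K V} {S : Finset V}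
    (hS : S ∈ generalSets m k W) (hq : 2 ^ (k + 1) ≤ Nat.card K) (hW'W : W' ≤ W)
    (hme : m ≤ e) (hW' : (W' : Set V).ncard = Nat.card K ^ e)
    (hk : k ≤ m ∨ W' ≤ affineSpan K (S : Set V)) :
    Nat.card K ^ e ≤ 2 * {p : V | p ∉ S ∧ insert p S ∈ generalSets m (k + 1) W}.ncard := by
  classical
  have := Fintype.ofFinite V
  obtain ⟨hc, -, -, -⟩ := mem_generalSets.1 hS
  have hsub : (W' : Set V) ⊆ {p : V | p ∉ S ∧ insert p S ∈ generalSets m (k + 1) W} ∪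
      ⋃ A ∈ S.powerset.filter (·.card ≤ m), (affineSpan K (A : Set V) : Set V) := by
    intro p hp
    by_cases hbad : ∃ A ⊆ S, A.card ≤ m ∧ p ∈ affineSpan K (A : Set V)
    · right
      obtain ⟨A, hA, hAm, hpA⟩ := hbad
      simp only [Set.mem_iUnion]
      exact ⟨A, by simp [hA, hAm], hpA⟩
    · left
      push Not at hbad
      have hpS : p ∉ S := fun h => hbad {p} (by simpa using h) (by simpa using hm)
        (subset_affineSpan K _ (by simp))
      exact ⟨hpS, insert_mem_generalSets hS (hW'W hp) hbad hpS (hk.imp_right fun h => h hp)⟩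
  have hbadcard : (⋃ A ∈ S.powerset.filter (·.card ≤ m),
      (affineSpan K (A : Set V) : Set V)).ncard ≤ 2 ^ k * Nat.card K ^ (m - 1) := by
    refine (Finset.set_ncard_biUnion_le _ _).trans ?_
    refine (Finset.sum_le_card_nsmul _ _ (Nat.card K ^ (m - 1)) fun A hA => ?_).trans ?_
    · exact ncard_affineSpan_le A (m - 1) (by have := (Finset.mem_filter.1 hA).2; omega)
    · rw [smul_eq_mul]
      refine Nat.mul_le_mul_right _ ((Finset.card_filter_le _ _).trans ?_)
      rw [Finset.card_powerset, hc]
  have h1 := (Set.ncard_le_ncard hsub).trans (Set.ncard_union_le _ _)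
  have h2 : 2 * (2 ^ k * Nat.card K ^ (m - 1)) ≤ Nat.card K ^ e := by
    calc 2 * (2 ^ k * Nat.card K ^ (m - 1)) = 2 ^ (k + 1) * Nat.card K ^ (m - 1) := by ring
      _ ≤ Nat.card K * Nat.card K ^ (m - 1) := Nat.mul_le_mul_right _ hq
      _ = Nat.card K ^ m := by rw [← pow_succ']; congr 1; omega
      _ ≤ Nat.card K ^ e := Nat.pow_le_pow_right Nat.card_pos hme
  rw [hW'] at h1
  omega

/-- The greedy construction has `q ^ d` candidates, up to a factor `2`, for each of the first
`m + 1` points, and `q ^ m` candidates for each later point. The factorial accounts for the order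
in which the points are chosen. -/
lemma le_card_generalSets [Finite K] {m d : ℕ} (hm : 1 ≤ m) (hmd : m ≤ d)
    {W : AffineSubspace K V} (hW : (W : Set V).ncard = Nat.card K ^ d) (k : ℕ)
    (hq : 2 ^ k ≤ Nat.card K) :
    Nat.card K ^ (d * min k (m + 1) + m * (k - (m + 1))) ≤
      2 ^ k * k.factorial * (generalSets m k W).card := by
  classical
  induction k with
  | zero =>
    have : (∅ : Finset V) ∈ generalSets m 0 W := by
      refine mem_generalSets.2 ⟨rfl, by simp, fun B hB _ => ?_, by
        rw [Finset.coe_empty, vectorSpan_empty]; simp⟩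
      obtain rfl := Finset.subset_empty.1 hB
      rw [Finset.coe_empty]
      exact affineIndependent_of_subsingleton K _
    have := Finset.card_pos.2 ⟨_, this⟩
    simpa using this
  | succ k ih =>
    specialize ih ((Nat.pow_le_pow_right (by norm_num) k.le_succ).trans hq)
    obtain ⟨e, hexp, he⟩ : ∃ e, d * min (k + 1) (m + 1) + m * (k + 1 - (m + 1)) =
        (d * min k (m + 1) + m * (k - (m + 1))) + e ∧ ∀ S ∈ generalSets m k W,
          Nat.card K ^ e ≤ 2 * {p : V | p ∉ S ∧ insert p S ∈ generalSets m (k + 1) W}.ncard := by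
      rcases le_or_gt k m with hk | hk
      · refine ⟨d, ?_, fun S hS => card_extensions_ge hm hS hq le_rfl hmd hW (.inl hk)⟩
        rw [min_eq_left (by omega), min_eq_left (by omega), Nat.sub_eq_zero_of_le (by omega),
          Nat.sub_eq_zero_of_le (by omega)]
        ring
      · refine ⟨m, ?_, fun S hS => card_extensions_ge (W' := affineSpan K (S : Set V)) hm hS hq
          (affineSpan_le.2 (mem_generalSets.1 hS).2.1) le_rfl ?_ (.inr le_rfl)⟩
        · obtain ⟨r, rfl⟩ := Nat.exists_eq_add_of_lt hk
          rw [min_eq_right (by omega), min_eq_right (by omega),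
            show m + r + 1 + 1 - (m + 1) = r + 1 by omega,
            show m + r + 1 - (m + 1) = r by omega]
          ring
        · obtain ⟨h1, h2⟩ := isFlat_affineSpan_of_mem_generalSets hS (by omega)
          rw [ncard_affineSubspace _ h1, h2]
    have hsum := sum_card_insert_le (generalSets m k W) (generalSets m (k + 1) W) (k + 1)
      fun S hS => (mem_generalSets.1 hS).1
    have hsum' := Finset.card_nsmul_le_sum _ _ _ he
    rw [smul_eq_mul, ← Finset.mul_sum] at hsum'
    rw [hexp, pow_add]
    calc _ ≤ 2 ^ k * k.factorial * (generalSets m k W).card * Nat.card K ^ e :=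
          Nat.mul_le_mul_right _ ih
      _ = 2 ^ k * k.factorial * ((generalSets m k W).card * Nat.card K ^ e) := by ring
      _ ≤ 2 ^ k * k.factorial * (2 * ((generalSets m (k + 1) W).card * (k + 1))) :=
          Nat.mul_le_mul_left _ (hsum'.trans (Nat.mul_le_mul_left _ hsum))
      _ = _ := by rw [Nat.factorial_succ]; ring

/-! ### Extensions of a given point set, and the number of flats -/

/-- To extend `T` to a member of `generalSets m ℓ W`, first extend it to a set of `m + 1` points,
anywhere in the space; the remaining points lie in the flat of dimension at most `m` spanned by
these. -/
lemma card_generalSets_superset_le [Finite K] [DecidableEq V] {m ℓ n : ℕ} (hmℓ : m < ℓ)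
    (hV : Nat.card V = Nat.card K ^ n) {W : AffineSubspace K V} (T : Finset V)
    (hT : T.card ≤ m + 1) :
    ((generalSets m ℓ W).filter (T ⊆ ·)).card ≤
      Nat.card K ^ (n * (m + 1 - T.card) + m * (ℓ - (m + 1))) := by
  classical
  have := Fintype.ofFinite V
  have hsub : (generalSets m ℓ W).filter (T ⊆ ·) ⊆
      (Finset.univ.powersetCard (m + 1 - T.card)).biUnion fun A =>
        ((affineSpan K ((T ∪ A : Finset V) : Set V) : Set V).toFinset.powersetCard
          (ℓ - (m + 1))).image fun C => T ∪ A ∪ C := by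
    intro S hS
    obtain ⟨hS, hTS⟩ := Finset.mem_filter.1 hS
    have hc := (mem_generalSets.1 hS).1
    obtain ⟨B, hTB, hBS, hB⟩ := Finset.exists_subsuperset_card_eq hTS hT (by omega)
    simp only [Finset.mem_biUnion, Finset.mem_image, Finset.mem_powersetCard]
    refine ⟨B \ T, ⟨Finset.subset_univ _, by rw [Finset.card_sdiff_of_subset hTB, hB]⟩, S \ B, ?_⟩
    rw [Finset.union_sdiff_of_subset hTB, affineSpan_eq_of_mem_generalSets hS hBS hB]
    refine ⟨⟨fun x hx => ?_, by rw [Finset.card_sdiff_of_subset hBS, hB, hc]⟩,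
      Finset.union_sdiff_of_subset hBS⟩
    simpa using subset_affineSpan K (S : Set V) (Finset.mem_sdiff.1 hx).1
  refine (Finset.card_le_card hsub).trans ?_
  rw [pow_add]
  refine (Finset.card_biUnion_le_card_mul _ _ (Nat.card K ^ (m * (ℓ - (m + 1)))) ?_).trans ?_
  · intro A hA
    refine Finset.card_image_le.trans ?_
    rw [Finset.card_powersetCard, pow_mul]
    refine (Nat.choose_le_pow _ _).trans (Nat.pow_le_pow_left ?_ _)
    rw [← Set.ncard_eq_toFinset_card']
    refine ncard_affineSpan_le _ _ ((Finset.card_union_le _ _).trans ?_)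
    rw [(Finset.mem_powersetCard.1 hA).2]
    omega
  · refine Nat.mul_le_mul_right _ ?_
    rw [Finset.card_powersetCard, Finset.card_univ, ← Nat.card_eq_fintype_card, hV, pow_mul]
    exact Nat.choose_le_pow _ _

/-- If `T` has at least `m + 1` points, it already determines the flat of any extension. -/
lemma card_generalSets_superset_le_of_le_card [Finite K] [DecidableEq V] {m ℓ : ℕ}
    {W : AffineSubspace K V} (T : Finset V) (hT : m + 1 ≤ T.card) :
    ((generalSets m ℓ W).filter (T ⊆ ·)).card ≤ Nat.card K ^ (m * (ℓ - T.card)) := by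
  classical
  have := Fintype.ofFinite V
  obtain ⟨B, hBT, hB⟩ := Finset.exists_subset_card_eq hT
  have hsub : (generalSets m ℓ W).filter (T ⊆ ·) ⊆
      ((affineSpan K (B : Set V) : Set V).toFinset.powersetCard (ℓ - T.card)).image (T ∪ ·) := by
    intro S hS
    obtain ⟨hS, hTS⟩ := Finset.mem_filter.1 hS
    have hc := (mem_generalSets.1 hS).1
    simp only [Finset.mem_image, Finset.mem_powersetCard]
    rw [affineSpan_eq_of_mem_generalSets hS (hBT.trans hTS) hB]
    refine ⟨S \ T, ⟨fun x hx => ?_, by rw [Finset.card_sdiff_of_subset hTS, hc]⟩,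
      Finset.union_sdiff_of_subset hTS⟩
    simpa using subset_affineSpan K (S : Set V) (Finset.mem_sdiff.1 hx).1
  refine (Finset.card_le_card hsub).trans (Finset.card_image_le.trans ?_)
  rw [Finset.card_powersetCard, pow_mul]
  refine (Nat.choose_le_pow _ _).trans (Nat.pow_le_pow_left ?_ _)
  rw [← Set.ncard_eq_toFinset_card']
  exact ncard_affineSpan_le _ _ hB.le

/-- The number of `m`-flats is at most a constant times `q ^ ((n - m) (m + 1))`, stated without
division: distinct flats have no affine basis in common, and each flat has at least a constant
times `q ^ (m (m + 1))` affine bases, by `le_card_generalSets` with `k = m + 1`. -/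
lemma card_flats_mul_le [Finite K] {m n : ℕ} (hm : 1 ≤ m) (hV : Nat.card V = Nat.card K ^ n)
    (hq : 2 ^ (m + 1) ≤ Nat.card K) (𝓛 : Finset (AffineSubspace K V))
    (h𝓛 : ∀ L ∈ 𝓛, IsFlat m L) :
    𝓛.card * Nat.card K ^ (m * (m + 1)) ≤
      2 ^ (m + 1) * (m + 1).factorial * Nat.card K ^ (n * (m + 1)) := by
  classical
  have := Fintype.ofFinite V
  have hdisj : (𝓛 : Set (AffineSubspace K V)).PairwiseDisjoint
      fun L => generalSets m (m + 1) L := by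
    intro L hL L' hL' hne
    refine Finset.disjoint_left.2 fun S hS hS' => hne ?_
    obtain ⟨hc, hSL, hind, -⟩ := mem_generalSets.1 hS
    obtain ⟨-, hSL', -, -⟩ := mem_generalSets.1 hS'
    rw [← affineSpan_eq_of_subset (h𝓛 L hL).2.le hc hSL (hind S subset_rfl hc.le),
      ← affineSpan_eq_of_subset (h𝓛 L' hL').2.le hc hSL' (hind S subset_rfl hc.le)]
  have hle : ∑ L ∈ 𝓛, (generalSets m (m + 1) L).card ≤ Nat.card K ^ (n * (m + 1)) := by
    rw [← Finset.card_biUnion hdisj]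
    have hsub : 𝓛.biUnion (fun L => generalSets m (m + 1) L) ⊆
        Finset.univ.powersetCard (m + 1) := by
      intro S hS
      obtain ⟨L, -, hS⟩ := Finset.mem_biUnion.1 hS
      exact Finset.mem_powersetCard.2 ⟨Finset.subset_univ _, (mem_generalSets.1 hS).1⟩
    refine (Finset.card_le_card hsub).trans ?_
    rw [Finset.card_powersetCard, Finset.card_univ, ← Nat.card_eq_fintype_card, hV, pow_mul]
    exact Nat.choose_le_pow _ _
  refine le_trans ?_ (Nat.mul_le_mul_left _ hle)
  rw [Finset.mul_sum, ← smul_eq_mul]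
  refine Finset.card_nsmul_le_sum _ _ _ fun L hL => ?_
  have := le_card_generalSets (W := L) hm le_rfl
    (by rw [ncard_affineSubspace _ (h𝓛 L hL).1, (h𝓛 L hL).2]) (m + 1) hq
  simpa using this

end Counting

/-! ### Probability bounds for rich flats -/

lemma natCard_fin_fun (K : Type*) (n : ℕ) : Nat.card (Fin n → K) = Nat.card K ^ n := by
  simp [Nat.card_fun]

section Threshold
variable {K : Type*} [Field K] [Finite K]

lemma setBernoulli_real_richFlatEvent_le {n m ℓ : ℕ} (hm : 1 ≤ m) (hmn : m ≤ n)
    (hq : 2 ^ (m + 1) ≤ Nat.card K) (θ : unitInterval) :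
    (setBernoulli (Set.univ : Set (Fin n → K)) θ).real (richFlatEvent K n m ℓ) ≤
      2 ^ (m + 1) * (m + 1).factorial *
        ((Nat.card K : ℝ) ^ ((n - m) * (m + 1) + m * ℓ) * (θ : ℝ) ^ ℓ) := by
  classical
  have hfin : Finite (AffineSubspace K (Fin n → K)) :=
    Finite.of_injective _ (SetLike.coe_injective (A := AffineSubspace K (Fin n → K)))
  set 𝓛 : Finset (AffineSubspace K (Fin n → K)) := (Set.toFinite {L | IsFlat m L}).toFinset
  have h𝓛 : ∀ L ∈ 𝓛, IsFlat m L := fun L hL => by simpa [𝓛] using hL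
  have hq0 : 0 < Nat.card K := Nat.card_pos
  have hcount : 𝓛.card ≤
      2 ^ (m + 1) * (m + 1).factorial * Nat.card K ^ ((n - m) * (m + 1)) := by
    have h := card_flats_mul_le hm (natCard_fin_fun K n) hq 𝓛 h𝓛
    rw [show n * (m + 1) = (n - m) * (m + 1) + m * (m + 1) by
      rw [← add_mul, Nat.sub_add_cancel hmn], pow_add (Nat.card K), ← mul_assoc] at h
    exact Nat.le_of_mul_le_mul_right h (by positivity)
  have hset : richFlatEvent K n m ℓ =
      {X | ∃ L ∈ 𝓛.image ((↑) : AffineSubspace K (Fin n → K) → Set (Fin n → K)),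
        ℓ ≤ (L ∩ X).ncard} := by
    ext X
    simp [richFlatEvent, IsRich, 𝓛]
  rw [hset]
  refine (setBernoulli_real_exists_le_ncard_inter_le θ _ (Nat.card K ^ m) ℓ ?_).trans ?_
  · intro L hL
    obtain ⟨L', hL', rfl⟩ := Finset.mem_image.1 hL
    rw [ncard_affineSubspace _ (h𝓛 L' hL').1, (h𝓛 L' hL').2]
  · have hθ : 0 ≤ (θ : ℝ) := θ.2.1
    have h1 : ((𝓛.image ((↑) : AffineSubspace K (Fin n → K) → Set (Fin n → K))).card : ℝ) ≤
        2 ^ (m + 1) * (m + 1).factorial * (Nat.card K : ℝ) ^ ((n - m) * (m + 1)) := by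
      exact_mod_cast Finset.card_image_le.trans hcount
    push_cast
    rw [mul_assoc, ← pow_mul]
    refine (mul_le_mul_of_nonneg_right h1 (by positivity)).trans_eq ?_
    rw [pow_add]
    ring

/-- The two bounds on the number of extensions of `T`, in terms of the threshold `t`. -/
lemma card_generalSets_superset_le_mul_pow [DecidableEq K] {n m ℓ : ℕ} (hmn : m ≤ n)
    (hmℓ : m < ℓ) {t : ℝ} (ht : 0 < t)
    (htQ : t ^ ℓ * (Nat.card K : ℝ) ^ ((n - m) * (m + 1) + m * ℓ) = 1)
    {W : AffineSubspace K (Fin n → K)} (T : Finset (Fin n → K)) (hT : T.card ≤ ℓ) :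
    (((generalSets m ℓ W).filter (T ⊆ ·)).card : ℝ) ≤
      (Nat.card K : ℝ) ^ ((n - m) * (m + 1) + m * ℓ) * t ^ T.card := by
  have hq : (1 : ℝ) ≤ Nat.card K := by exact_mod_cast Nat.card_pos
  have hℓ : ℓ ≠ 0 := by omega
  obtain ⟨d, rfl⟩ := Nat.exists_eq_add_of_le hmn
  obtain ⟨r, rfl⟩ := Nat.exists_eq_add_of_lt hmℓ
  rw [Nat.add_sub_cancel_left] at htQ ⊢
  rcases le_total T.card (m + 1) with hj | hj
  -- Few points: here `q ^ (-n) ≤ t`, with `n = m + d`, is what is needed.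
  · have h1 : 1 ≤ t * (Nat.card K : ℝ) ^ (m + d) := by
      rw [← one_le_pow_iff_of_nonneg (by positivity) hℓ, mul_pow, ← pow_mul, ← htQ]
      refine mul_le_mul_of_nonneg_left (pow_le_pow_right₀ hq ?_) (by positivity)
      nlinarith [Nat.zero_le (d * r)]
    refine (Nat.cast_le.2 (card_generalSets_superset_le hmℓ (natCard_fin_fun K _) T hj)).trans ?_
    push_cast
    refine (le_mul_of_one_le_right (by positivity) (one_le_pow₀ h1 (n := T.card))).trans_eq ?_
    rw [mul_pow, mul_left_comm, ← pow_mul, ← pow_add, mul_comm (t ^ _)]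
    congr 2
    obtain ⟨i, hi⟩ := Nat.exists_eq_add_of_le hj
    rw [show m + r - m = r by omega, show m + 1 - T.card = i by omega]
    have : (m + d) * (m + 1) = (m + d) * (T.card + i) := by rw [← hi]
    linarith
  -- Many points: here `t ≤ q ^ (-m)` is what is needed.
  · have h1 : t * (Nat.card K : ℝ) ^ m ≤ 1 := by
      rw [← pow_le_one_iff_of_nonneg (by positivity) hℓ, mul_pow, ← pow_mul, ← htQ]
      exact mul_le_mul_of_nonneg_left (pow_le_pow_right₀ hq (Nat.le_add_left _ _)) (by positivity)
    refine (Nat.cast_le.2 (card_generalSets_superset_le_of_le_card T hj)).trans ?_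
    push_cast
    refine le_trans (Eq.le ?_) (mul_le_of_le_one_right (by positivity)
      (pow_le_one₀ (by positivity) h1 (n := m + r + 1 - T.card)))
    rw [mul_pow, ← pow_mul]
    nth_rw 1 [← one_mul ((Nat.card K : ℝ) ^ _), ← htQ, ← Nat.add_sub_cancel' hT, pow_add]
    ring

lemma one_sub_le_setBernoulli_real_richFlatEvent {n m ℓ : ℕ} (hm : 1 ≤ m) (hmn : m ≤ n)
    (hmℓ : m < ℓ) (hq : 2 ^ ℓ ≤ Nat.card K) (θ : unitInterval) {t : ℝ} (ht : 0 < t)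
    (htθ : t ≤ θ) (htQ : t ^ ℓ * (Nat.card K : ℝ) ^ ((n - m) * (m + 1) + m * ℓ) = 1) :
    1 - 2 ^ ℓ * (2 ^ ℓ * ℓ.factorial * (t / θ)) ≤
      (setBernoulli (Set.univ : Set (Fin n → K)) θ).real (richFlatEvent K n m ℓ) := by
  classical
  set 𝓢 : Finset (Finset (Fin n → K)) := generalSets m ℓ (⊤ : AffineSubspace K (Fin n → K))
  have hθ : 0 < (θ : ℝ) := ht.trans_le htθ
  have hN : (Nat.card K : ℝ) ^ ((n - m) * (m + 1) + m * ℓ) ≤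
      2 ^ ℓ * ℓ.factorial * 𝓢.card := by
    have h := le_card_generalSets (W := (⊤ : AffineSubspace K (Fin n → K))) hm hmn
      (by simp [Set.ncard_univ, natCard_fin_fun]) ℓ hq
    rw [min_eq_right hmℓ] at h
    have he : n * (m + 1) + m * (ℓ - (m + 1)) = (n - m) * (m + 1) + m * ℓ := by
      obtain ⟨d, rfl⟩ := Nat.exists_eq_add_of_le hmn
      obtain ⟨r, rfl⟩ := Nat.exists_eq_add_of_lt hmℓ
      rw [show m + r + 1 - (m + 1) = r by omega, Nat.add_sub_cancel_left]
      ring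
    rw [he] at h
    exact_mod_cast h
  have hne : 𝓢.Nonempty := by
    rw [Finset.nonempty_iff_ne_empty]
    intro h0
    rw [h0, Finset.card_empty, Nat.cast_zero, mul_zero] at hN
    have : (0 : ℝ) < Nat.card K := by exact_mod_cast Nat.card_pos
    exact absurd hN (not_le.2 (by positivity))
  have hkey := setBernoulli_real_forall_not_subset_le θ hθ ℓ 𝓢 hne
    (fun S hS => (mem_generalSets.1 hS).1) (2 ^ ℓ * ℓ.factorial * (t / θ)) (by positivity) ?_
  · have hsub : {X : Set (Fin n → K) | ∀ S ∈ 𝓢, ¬ (S : Set (Fin n → K)) ⊆ X}ᶜ ⊆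
        richFlatEvent K n m ℓ := by
      intro X hX
      simp only [Set.mem_compl_iff, Set.mem_ofPred_eq, not_forall, not_not] at hX
      obtain ⟨S, hS, hSX⟩ := hX
      refine ⟨_, isFlat_affineSpan_of_mem_generalSets hS hmℓ, ?_⟩
      rw [IsRich, ← (mem_generalSets.1 hS).1, ← Set.ncard_coe_finset]
      exact Set.ncard_le_ncard (Set.subset_inter (subset_affineSpan K _) hSX)
    refine le_trans ?_ (measureReal_mono hsub (measure_ne_top _ _))
    rw [measureReal_compl MeasurableSet.of_discrete, probReal_univ]
    linarith
  · intro S hS T hTS hT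
    have hTc : T.card ≤ ℓ := (Finset.card_le_card hTS).trans_eq (mem_generalSets.1 hS).1
    have htj : t ^ T.card ≤ t / θ * (θ : ℝ) ^ T.card := by
      obtain ⟨j, hj⟩ := Nat.exists_eq_succ_of_ne_zero hT.card_pos.ne'
      rw [hj, pow_succ', pow_succ', ← mul_assoc, div_mul_cancel₀ _ hθ.ne']
      exact mul_le_mul_of_nonneg_left (pow_le_pow_left₀ ht.le htθ j) ht.le
    calc _ ≤ (Nat.card K : ℝ) ^ ((n - m) * (m + 1) + m * ℓ) * t ^ T.card := by
          convert card_generalSets_superset_le_mul_pow hmn hmℓ ht htQ T hTc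
      _ ≤ (2 ^ ℓ * ℓ.factorial * 𝓢.card) * (t / θ * (θ : ℝ) ^ T.card) := by gcongr
      _ = _ := by ring

end Threshold

/-! ### The threshold -/

theorem mainTheorem2 (F : ℕ → Type*) [∀ i, Field (F i)] [∀ i, Finite (F i)] (n m ℓ : ℕ → ℕ)
    (hq : Tendsto (fun i => Nat.card (F i)) atTop atTop)
    (hn : ∀ i, 3 ≤ n i)
    (hm : ∀ i, 1 ≤ m i ∧ m i ≤ n i)
    (hmℓ : ∀ i, m i < ℓ i)
    (hm_bdd : BddAbove (Set.range m))
    (hℓ_bdd : BddAbove (Set.range ℓ)) :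
    IsThreshold (fun i => richFlatEvent (F i) (n i) (m i) (ℓ i))
      (fun i => ((Nat.card (F i) : ℝ) ^ ((n i - m i) * (m i + 1) + m i * ℓ i)) ^
        (-1 / (ℓ i : ℝ))) := by
  obtain ⟨Λ, hΛ⟩ := hℓ_bdd
  replace hΛ : ∀ i, ℓ i ≤ Λ := fun i => hΛ ⟨i, rfl⟩
  set t : ℕ → ℝ := fun i => ((Nat.card (F i) : ℝ) ^ ((n i - m i) * (m i + 1) + m i * ℓ i)) ^
        (-1 / (ℓ i : ℝ)) with ht_def
  have hq0 : ∀ i, (0 : ℝ) < Nat.card (F i) := fun i => by exact_mod_cast Nat.card_pos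
  have ht : ∀ i, 0 < t i := fun i => Real.rpow_pos_of_pos (pow_pos (hq0 i) _) _
  have htQ : ∀ i, t i ^ ℓ i * (Nat.card (F i) : ℝ) ^ ((n i - m i) * (m i + 1) + m i * ℓ i) = 1 := by
    intro i
    have hℓ : (ℓ i : ℝ) ≠ 0 := by
      have := hmℓ i
      exact_mod_cast (by omega : ℓ i ≠ 0)
    have hQ := pow_pos (hq0 i) ((n i - m i) * (m i + 1) + m i * ℓ i)
    rw [ht_def]
    simp only
    rw [← Real.rpow_mul_natCast hQ.le, div_mul_cancel₀ _ hℓ, Real.rpow_neg_one,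
      inv_mul_cancel₀ hQ.ne']
  have hqΛ : ∀ᶠ i in atTop, 2 ^ Λ ≤ Nat.card (F i) := hq.eventually_ge_atTop _
  have hfac : ∀ k ≤ Λ, (2 : ℝ) ^ k * k.factorial ≤ 2 ^ Λ * Λ.factorial := fun k hk => by
    have := Nat.factorial_le hk
    gcongr
    norm_num
  refine ⟨fun θ hθ => ?_, fun θ hθ => ?_⟩
  · have hlim := hθ.tendsto_div_nhds_zero
    have hlim' := hlim.const_mul ((2 : ℝ) ^ Λ * Λ.factorial)
    rw [mul_zero] at hlim'
    refine squeeze_zero' (Eventually.of_forall fun i => measureReal_nonneg) ?_ hlim'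
    filter_upwards [hqΛ, hlim.eventually_le_const one_pos] with i hi hr
    have hr0 : 0 ≤ (θ i : ℝ) / t i := div_nonneg (θ i).2.1 (ht i).le
    have hmΛ : m i + 1 ≤ Λ := (hmℓ i).trans_le (hΛ i)
    refine (setBernoulli_real_richFlatEvent_le (hm i).1 (hm i).2
      ((Nat.pow_le_pow_right two_pos hmΛ).trans hi) (θ i)).trans ?_
    refine mul_le_mul (hfac _ hmΛ) ?_ (by have := (θ i).2.1; positivity) (by positivity)
    refine le_trans (Eq.le ?_) (pow_le_of_le_one hr0 hr (n := ℓ i) (by have := hmℓ i; omega))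
    rw [div_pow, eq_div_iff (pow_pos (ht i) _).ne', mul_right_comm, mul_comm (_ ^ _) (t i ^ _),
      htQ i, one_mul]
  · have hlim := hθ.tendsto_div_nhds_zero
    have hlim' := (hlim.const_mul ((2 : ℝ) ^ Λ * (2 ^ Λ * Λ.factorial))).const_sub 1
    rw [mul_zero, sub_zero] at hlim'
    refine tendsto_of_tendsto_of_tendsto_of_le_of_le' hlim' tendsto_const_nhds ?_
      (Eventually.of_forall fun i => measureReal_le_one)
    filter_upwards [hqΛ, hθ.bound one_pos] with i hi hr
    rw [one_mul, Real.norm_of_nonneg (ht i).le, Real.norm_of_nonneg (θ i).2.1] at hr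
    refine le_trans ?_ (one_sub_le_setBernoulli_real_richFlatEvent (hm i).1 (hm i).2 (hmℓ i)
      ((Nat.pow_le_pow_right two_pos (hΛ i)).trans hi) (θ i) (ht i) hr (htQ i))
    have hr0 : 0 ≤ t i / (θ i : ℝ) := div_nonneg (ht i).le (θ i).2.1
    rw [mul_assoc (2 ^ Λ)]
    have h2 : (2 : ℝ) ^ ℓ i ≤ 2 ^ Λ := pow_le_pow_right₀ one_le_two (hΛ i)
    have h3 := hfac _ (hΛ i)
    gcongr
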